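/- Call a non-negative Borel measure $\mu$ on $\mathbb{R}$ admissible if $s_k(\mu) := \int x^k \, d\mu$ is finite (with $x^k$ $\mu$-integrable) for every integer $k \ge 0$. For a closed set $K \subset \mathbb{R}$, let $\mathcal{M}(K)$ be the set of all moment sequences $(s_0(\mu), s_1(\mu), \dots)$, and, for $n \ge 0$, let $\mathcal{M}_n(K)$ be the set of all truncated moment sequences $(s_0(\mu), \dots, s_n(\mu))$, where $\mu$ runs over the admissible measures supported on $K$. A function $F : \mathbb{R} \to \mathbb{R}$ acts on finite and infinite real sequences entrywise, $F[(s_k)_k] := (F(s_k))_k$. An absolutely monotonic entire function is an entire function whose Taylor coefficients at every point of $(0,\infty)$ are non-negative real numbers. **Theorem 6.3.** Let $F : \mathbb{R} \to \mathbb{R}$ and $u_0 \in (0,1)$. The following are equivalent. 1. $F[-]$ maps $\mathcal{M}(\{-1,-u_0\})$ into $\mathcal{M}([0,\infty))$, and maps $\mathcal{M}_4(\{-1,0\}) \cup \bigcup_{u \in (0,1)} \mathcal{M}_4(\{-u\})$ into $\mathcal{M}_4([0,\infty))$. 2. $F[-]$ maps $\mathcal{M}([-1,0])$ into $\mathcal{M}([0,1])$.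 3. There exists an absolutely monotonic entire function $\widetilde{F}$ such that $F(x) = \widetilde{F}(x)$ for all $x > 0$ and $F(x) = \widetilde{F}(-x)$ for all $x < 0$; moreover, the limit $\lim_{\epsilon \to 0,\ \epsilon \neq 0} F(\epsilon)$ exists and $0 \le F(0) \le \lim_{\epsilon \to 0,\ \epsilon \neq 0} F(\epsilon)$. -/

import Mathlib

open MeasureTheory Filter Topology

/-- An admissible measure carried by `K`: a (non-negative Borel) measure on the real line with
finite moments of all orders (in particular of finite mass), giving no mass to the complement
of `K`. For closed `K` this says that the support of `μ` is contained in `K`. -/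
structure IsAdmissibleOn (K : Set ℝ) (μ : Measure ℝ) : Prop where
  integrable_pow : ∀ k : ℕ, Integrable (fun x : ℝ => x ^ k) μ
  compl_null : μ Kᶜ = 0

/-- The `k`-th power moment `s_k(μ)`. -/
noncomputable def powerMoment (μ : Measure ℝ) (k : ℕ) : ℝ := ∫ x, x ^ k ∂μ

/-- The set `𝓜(K)` of moment sequences `(s_0(μ), s_1(μ), …)` of admissible measures on `K`. -/
def momentSeqs (K : Set ℝ) : Set (ℕ → ℝ) :=
  {s | ∃ μ : Measure ℝ, IsAdmissibleOn K μ ∧ ∀ k, s k = powerMoment μ k}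

/-- The set `𝓜_n(K)` of truncated moment sequences `(s_0(μ), …, s_n(μ))` of admissible measures
on `K`. -/
def truncMomentSeqs (n : ℕ) (K : Set ℝ) : Set (Fin (n + 1) → ℝ) :=
  {s | ∃ μ : Measure ℝ, IsAdmissibleOn K μ ∧ ∀ k : Fin (n + 1), s k = powerMoment μ k}

/-- The entrywise action `F[-]` of a function on finite or infinite sequences. -/
def entrywise {ι : Type*} (F : ℝ → ℝ) (s : ι → ℝ) : ι → ℝ := fun i => F (s i)

/-- An absolutely monotonic entire function: an entire function of a complex variable all of whose
derivatives (equivalently, Taylor coefficients) at every point of `(0, ∞)` are non-negative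
real numbers. -/
structure IsAbsMonotonicEntire (G : ℂ → ℂ) : Prop where
  entire : Differentiable ℂ G
  deriv_nonneg : ∀ x : ℝ, 0 < x → ∀ n : ℕ,
    0 ≤ (iteratedDeriv n G (x : ℂ)).re ∧ (iteratedDeriv n G (x : ℂ)).im = 0

/-! From (1) to (3): for `0 ≤ a ≤ c` the measure `a δ_{-1} + (c - a) δ_0` has moments `(c, -a, a,
-a, a)`. Testing the image sequence against `x ^ m * (1 - x) ^ 2` for `m = 0, 1, 2` makes `F` even,
and non-negative and monotone on `[0, ∞)` (`even_monotone_of_mapsTo_trunc`). Evenness absorbs the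
signs in `(-1) ^ k * (a + b * u ^ k)`, so the values `F (a + b * u ^ k)` are moments of a measure
and pair non-negatively with squares of polynomials (`geometric_nonneg_of_mapsTo`). For smooth `F`,
differentiating this inequality in `b` at `0`, with a polynomial that kills the lower orders, gives
every derivative the right sign (`iteratedDeriv_nonneg_of_geometric`), and Bernstein's theorem
yields a power series. Monotone `F` is mollified first; compactness of the coefficients and a
sandwich by translates recover `F` itself (`exists_hasSum_of_power_series_sandwich`). From (3) to
(2): after reflection to `[0, 1]`, multiplicative convolution realises powers of moments, and a
weighted sum of convolution powers realises the power series. Only measures concentrated at `0` see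
the value `F 0`. From (2) to (1) it is enough to restrict and truncate. -/

open scoped ContDiff Nat Convolution

/-! ### Entire power series with non-negative coefficients -/

theorem hasFPowerSeriesOnBall_tsum_of_summable {a : ℕ → ℝ}
    (hs : ∀ r : ℝ, 0 ≤ r → Summable fun n => |a n| * r ^ n) :
    HasFPowerSeriesOnBall (fun z : ℂ => ∑' n, (a n : ℂ) * z ^ n)
      (FormalMultilinearSeries.ofScalars ℂ fun n => (a n : ℂ)) 0 ⊤ := by
  have hrad : (FormalMultilinearSeries.ofScalars ℂ fun n => (a n : ℂ)).radius = ⊤ := by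
    refine FormalMultilinearSeries.radius_eq_top_of_summable_norm _ fun r => ?_
    simpa [FormalMultilinearSeries.ofScalars_norm] using hs r r.2
  have h := (FormalMultilinearSeries.ofScalars ℂ fun n => (a n : ℂ)).hasFPowerSeriesOnBall
    (by simp [hrad])
  rw [hrad] at h
  refine h.congr fun z _ => ?_
  simp [FormalMultilinearSeries.sum, mul_comm]

theorem differentiable_tsum_of_summable {a : ℕ → ℝ}
    (hs : ∀ r : ℝ, 0 ≤ r → Summable fun n => |a n| * r ^ n) :
    Differentiable ℂ fun z : ℂ => ∑' n, (a n : ℂ) * z ^ n := fun z =>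
  ((hasFPowerSeriesOnBall_tsum_of_summable hs).analyticAt_of_mem (by simp)).differentiableAt

theorem iteratedDeriv_tsum_zero {a : ℕ → ℝ}
    (hs : ∀ r : ℝ, 0 ≤ r → Summable fun n => |a n| * r ^ n) (n : ℕ) :
    iteratedDeriv n (fun z : ℂ => ∑' n, (a n : ℂ) * z ^ n) 0 = ((n ! * a n : ℝ) : ℂ) := by
  have h := (hasFPowerSeriesOnBall_tsum_of_summable hs).hasFPowerSeriesAt
  have h' := h.eq_formalMultilinearSeries h.analyticAt.hasFPowerSeriesAt
  have := congrFun (FormalMultilinearSeries.ofScalars_series_injective ℂ ℂ h') n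
  have hn : (n ! : ℂ) ≠ 0 := by exact_mod_cast n.factorial_ne_zero
  simp only [eq_div_iff hn] at this
  rw [← this]
  push_cast
  ring

theorem iteratedDeriv_iteratedDeriv {𝕜 E : Type*} [NontriviallyNormedField 𝕜]
    [NormedAddCommGroup E] [NormedSpace 𝕜 E] (f : 𝕜 → E) (m n : ℕ) :
    iteratedDeriv m (iteratedDeriv n f) = iteratedDeriv (m + n) f := by
  simp only [iteratedDeriv_eq_iterate, Function.iterate_add_apply]

theorem Differentiable.differentiable_iteratedDeriv_complex {G : ℂ → ℂ} (hG : Differentiable ℂ G)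
    (n : ℕ) : Differentiable ℂ (iteratedDeriv n G) :=
  (hG.contDiff (n := ω)).differentiable_iteratedDeriv n (by simp)

theorem hasSum_iteratedDeriv_of_real_at_zero {G : ℂ → ℂ} (hG : Differentiable ℂ G) {d : ℕ → ℝ}
    (hd : ∀ n, iteratedDeriv n G 0 = d n) (n : ℕ) (x : ℝ) :
    HasSum (fun k => ((((k ! : ℝ)⁻¹ * d (k + n) * x ^ k : ℝ)) : ℂ)) (iteratedDeriv n G x) := by
  have h := Complex.hasSum_taylorSeries_of_entire (hG.differentiable_iteratedDeriv_complex n) 0 x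
  convert! h using 2 with k
  rw [iteratedDeriv_iteratedDeriv, hd]
  push_cast
  simp only [sub_zero, smul_eq_mul]
  ring

theorem IsAbsMonotonicEntire.of_hasSum {a : ℕ → ℝ} (ha : ∀ n, 0 ≤ a n)
    (hs : ∀ r : ℝ, 0 ≤ r → Summable fun n => a n * r ^ n) :
    IsAbsMonotonicEntire fun z : ℂ => ∑' n, (a n : ℂ) * z ^ n := by
  have hs' : ∀ r : ℝ, 0 ≤ r → Summable fun n => |a n| * r ^ n := by
    simpa only [abs_of_nonneg (ha _)] using hs
  refine ⟨differentiable_tsum_of_summable hs', fun x hx n => ?_⟩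
  have h := hasSum_iteratedDeriv_of_real_at_zero (differentiable_tsum_of_summable hs')
    (iteratedDeriv_tsum_zero hs') n x
  constructor
  · refine (Complex.hasSum_re h).nonneg fun k => ?_
    have := ha (k + n)
    simp only [Complex.ofReal_re]
    positivity
  · have := Complex.hasSum_im h
    simp only [Complex.ofReal_im] at this
    exact this.unique hasSum_zero

/-- Continuity carries the sign conditions from `(0, ∞)` to the endpoint `0`, the centre of the
expansion used later. -/
theorem IsAbsMonotonicEntire.deriv_zero_nonneg {G : ℂ → ℂ} (hG : IsAbsMonotonicEntire G) (n : ℕ) :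
    0 ≤ (iteratedDeriv n G 0).re ∧ (iteratedDeriv n G 0).im = 0 := by
  have hc : Continuous fun x : ℝ => iteratedDeriv n G x :=
    (hG.entire.differentiable_iteratedDeriv_complex n).continuous.comp Complex.continuous_ofReal
  have ht : Tendsto (fun x : ℝ => iteratedDeriv n G x) (𝓝[>] 0) (𝓝 (iteratedDeriv n G 0)) := by
    simpa using (hc.tendsto 0).mono_left nhdsWithin_le_nhds
  have hpos : ∀ᶠ x : ℝ in 𝓝[>] 0, 0 < x := self_mem_nhdsWithin
  constructor
  · exact ge_of_tendsto ((Complex.continuous_re.tendsto _).comp ht)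
      (hpos.mono fun x hx => (hG.deriv_nonneg x hx n).1)
  · refine tendsto_nhds_unique ((Complex.continuous_im.tendsto _).comp ht)
      (tendsto_const_nhds.congr' (hpos.mono fun x hx => ?_))
    exact (hG.deriv_nonneg x hx n).2.symm

theorem IsAbsMonotonicEntire.exists_hasSum {G : ℂ → ℂ} (hG : IsAbsMonotonicEntire G) :
    ∃ a : ℕ → ℝ, (∀ n, 0 ≤ a n) ∧
      ∀ x : ℝ, HasSum (fun n => ((a n * x ^ n : ℝ) : ℂ)) (G x) := by
  have h0 := hG.deriv_zero_nonneg
  have hd : ∀ n, iteratedDeriv n G 0 = ((iteratedDeriv n G 0).re : ℝ) := fun n =>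
    Complex.ext (by simp) (by simp [(h0 n).2])
  refine ⟨fun n => (n ! : ℝ)⁻¹ * (iteratedDeriv n G 0).re, fun n => ?_, fun x => ?_⟩
  · have := (h0 n).1
    positivity
  · simpa using hasSum_iteratedDeriv_of_real_at_zero hG.entire hd 0 x

/-! ### Bernstein's theorem for smooth functions -/

theorem exists_lagrange_remainder {f : ℝ → ℝ} (hf : ContDiff ℝ ∞ f) {a x : ℝ} (hax : a < x)
    (n : ℕ) : ∃ ξ ∈ Set.Ioo a x, f x =
      (∑ k ∈ Finset.range (n + 1), iteratedDeriv k f a / k ! * (x - a) ^ k) +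
        iteratedDeriv (n + 1) f ξ * (x - a) ^ (n + 1) / (n + 1)! := by
  obtain ⟨ξ, hξ, h⟩ := taylor_mean_remainder_lagrange_iteratedDeriv (n := n) hax.ne
    ((hf.of_le (by exact_mod_cast le_top)).contDiffOn)
  rw [Set.uIoo_of_lt hax] at hξ
  refine ⟨ξ, hξ, ?_⟩
  rw [← h, taylor_within_apply, Set.uIcc_of_lt hax]
  have : ∀ k ∈ Finset.range (n + 1), iteratedDeriv k f a / k ! * (x - a) ^ k =
      ((k ! : ℝ)⁻¹ * (x - a) ^ k) • iteratedDerivWithin k f (Set.Icc a x) a := fun k _ => by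
    rw [iteratedDerivWithin_eq_iteratedDeriv (uniqueDiffOn_Icc hax)
      (hf.contDiffAt.of_le (by exact_mod_cast le_top)) (Set.left_mem_Icc.2 hax.le), smul_eq_mul]
    ring
  rw [Finset.sum_congr rfl this]
  ring

/-- A smooth function vanishing to order `n` at `0` and non-negative on the right of `0` has
non-negative `n`-th derivative at `0`. -/
theorem iteratedDeriv_zero_nonneg_of_vanishing {g : ℝ → ℝ} (hg : ContDiff ℝ ∞ g)
    (hpos : ∀ b, 0 ≤ b → 0 ≤ g b) {n : ℕ} (hz : ∀ m < n, iteratedDeriv m g 0 = 0) :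
    0 ≤ iteratedDeriv n g 0 := by
  rcases n with _ | n
  · simpa using hpos 0 le_rfl
  by_contra! hneg
  have hc : Continuous (iteratedDeriv (n + 1) g) :=
    hg.continuous_iteratedDeriv _ (by exact_mod_cast le_top)
  obtain ⟨δ, hδ, hball⟩ := Metric.eventually_nhds_iff.1 (hc.tendsto 0 |>.eventually_lt_const hneg)
  obtain ⟨ξ, hξ, h⟩ := exists_lagrange_remainder hg hδ n
  rw [Finset.sum_eq_zero fun k hk => by rw [hz k (by simpa using hk)]; simp, zero_add] at h
  have h1 : iteratedDeriv (n + 1) g ξ < 0 := hball (by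
    rw [Real.dist_eq, sub_zero, abs_of_pos hξ.1]; exact hξ.2)
  have h2 := hpos δ hδ.le
  rw [h, sub_zero] at h2
  have h3 : 0 < δ ^ (n + 1) / (n + 1)! := by positivity
  rw [mul_div_assoc] at h2
  nlinarith [mul_neg_of_neg_of_pos h1 h3]

/-- Bernstein's argument: the Lagrange remainder at `x` is at most a multiple of one non-negative
term of the expansion of `f (3 * x)` about `x`, and that multiple decays geometrically. -/
theorem hasSum_taylor_of_iteratedDeriv_nonneg {f : ℝ → ℝ} (hf : ContDiff ℝ ∞ f)
    (hd : ∀ n x, 0 ≤ x → 0 ≤ iteratedDeriv n f x) {x : ℝ} (hx : 0 < x) :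
    HasSum (fun n => iteratedDeriv n f 0 / n ! * x ^ n) (f x) := by
  have hcoef : ∀ n, ∀ t, 0 ≤ t → ∀ s : ℝ, 0 ≤ s → 0 ≤ iteratedDeriv n f t / n ! * s ^ n :=
    fun n t ht s hs => by have := hd n t ht; positivity
  have hmono : ∀ n, MonotoneOn (iteratedDeriv n f) (Set.Ici 0) := fun n => by
    have hdiff : Differentiable ℝ (iteratedDeriv n f) :=
      hf.differentiable_iteratedDeriv n (by exact_mod_cast WithTop.coe_lt_top _)
    refine monotoneOn_of_deriv_nonneg (convex_Ici 0) hdiff.continuous.continuousOn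
      hdiff.differentiableOn fun t ht => ?_
    rw [interior_Ici] at ht
    rw [← iteratedDeriv_succ]
    exact hd _ _ (le_of_lt ht)
  rw [hasSum_iff_tendsto_nat_of_nonneg (fun n => hcoef n 0 le_rfl x hx.le)]
  rw [← tendsto_add_atTop_iff_nat 1]
  have hbound : ∀ n, dist (∑ k ∈ Finset.range (n + 1), iteratedDeriv k f 0 / k ! * x ^ k) (f x) ≤
      f (3 * x) * (1 / 2) ^ (n + 1) := fun n => by
    obtain ⟨ξ, hξ, h⟩ := exists_lagrange_remainder hf hx n
    -- The increment from `x` to `3 * x` is twice that from `0` to `x`; this ratio is the source of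
    -- the factor `(1 / 2) ^ (n + 1)`.
    obtain ⟨η, hη, h'⟩ := exists_lagrange_remainder hf (show x < 3 * x by linarith) (n + 1)
    have hx2 : 3 * x - x = 2 * x := by ring
    rw [Finset.sum_range_succ, hx2] at h'
    have h0 : 0 ≤ ∑ k ∈ Finset.range (n + 1), iteratedDeriv k f x / k ! * (2 * x) ^ k :=
      Finset.sum_nonneg fun k _ => hcoef k x hx.le _ (by linarith)
    have h1 : 0 ≤ iteratedDeriv (n + 1 + 1) f η * (2 * x) ^ (n + 1 + 1) / (n + 1 + 1)! := by
      have := hd (n + 1 + 1) η (hx.trans hη.1).le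
      positivity
    have h2 : iteratedDeriv (n + 1) f ξ ≤ iteratedDeriv (n + 1) f x :=
      hmono _ hξ.1.le hx.le hξ.2.le
    simp only [sub_zero] at h
    have h3 : 0 ≤ iteratedDeriv (n + 1) f ξ * x ^ (n + 1) / (n + 1)! := by
      have := hd (n + 1) ξ hξ.1.le
      positivity
    rw [dist_comm, Real.dist_eq, h, add_sub_cancel_left, abs_of_nonneg h3]
    have h4 : iteratedDeriv (n + 1) f x / (n + 1)! * (2 * x) ^ (n + 1) ≤ f (3 * x) := by
      linarith
    calc iteratedDeriv (n + 1) f ξ * x ^ (n + 1) / (n + 1)!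
        ≤ iteratedDeriv (n + 1) f x * x ^ (n + 1) / (n + 1)! := by gcongr
      _ = iteratedDeriv (n + 1) f x / (n + 1)! * (2 * x) ^ (n + 1) * (1 / 2) ^ (n + 1) := by
          rw [mul_assoc _ ((2 * x) ^ _), ← mul_pow]
          ring
      _ ≤ _ := by gcongr
  rw [tendsto_iff_dist_tendsto_zero]
  refine squeeze_zero (fun _ => dist_nonneg) hbound ?_
  have := (tendsto_pow_atTop_nhds_zero_of_lt_one (r := (1 / 2 : ℝ)) (by norm_num)
    (by norm_num)).comp (tendsto_add_atTop_nat 1)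
  simpa using this.const_mul (f (3 * x))

/-! ### Limits of power series with non-negative coefficients -/

/-- Cauchy-type bounds put the coefficients in a compact product of intervals, so a subsequence
converges coefficientwise; the bound at radius `2 * x` dominates the series at `x`. -/
theorem exists_hasSum_of_power_series_sandwich {H : ℝ → ℝ} (hH : Monotone H) (f : ℕ → ℝ → ℝ)
    (c : ℕ → ℕ → ℝ) (hc : ∀ m n, 0 ≤ c m n)
    (hsum : ∀ m, ∀ x : ℝ, 0 < x → HasSum (fun n => c m n * x ^ n) (f m x)) (ε : ℕ → ℝ)
    (hε : Tendsto ε atTop (𝓝 0)) (hε1 : ∀ m, ε m ≤ 1)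
    (hlow : ∀ m x, H x ≤ f m x) (hup : ∀ m x, f m x ≤ H (x + ε m)) :
    ∃ a : ℕ → ℝ, (∀ n, 0 ≤ a n) ∧ ∀ x : ℝ, 0 < x → HasSum (fun n => a n * x ^ n) (H x) := by
  have hbd : ∀ m n, ∀ R : ℝ, 0 < R → c m n * R ^ n ≤ H (R + 1) := fun m n R hR =>
    (le_hasSum (hsum m R hR) n fun k _ => by have := hc m k; positivity).trans
      ((hup m R).trans (hH (by linarith [hε1 m])))
  have hcpt : IsCompact (Set.univ.pi fun _ : ℕ => Set.Icc (0 : ℝ) (H (1 + 1))) :=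
    isCompact_univ_pi fun _ => isCompact_Icc
  obtain ⟨a, ha, κ, hκ, hlim⟩ := hcpt.tendsto_subseq (x := c) fun m => by
    simp only [Set.mem_univ_pi]
    exact fun n => ⟨hc m n, by simpa using hbd m n 1 one_pos⟩
  rw [tendsto_pi_nhds] at hlim
  have ha0 : ∀ n, 0 ≤ a n := fun n => (ha n (Set.mem_univ n)).1
  have hgeom : ∀ x : ℝ, Summable fun n : ℕ => H (2 * x + 1) * (1 / 2 : ℝ) ^ n := fun x =>
    (summable_geometric_of_lt_one (by norm_num) (by norm_num)).mul_left _
  have hterm : ∀ x : ℝ, 0 < x → ∀ m n, c m n * x ^ n ≤ H (2 * x + 1) * (1 / 2) ^ n :=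
    fun x hx m n => by
      have h := hbd m n (2 * x) (by linarith)
      calc c m n * x ^ n = c m n * (2 * x) ^ n * (1 / 2) ^ n := by
            rw [mul_assoc, ← mul_pow]; ring
        _ ≤ _ := by gcongr
  have hsa : ∀ x : ℝ, 0 < x → Summable fun n => a n * x ^ n := fun x hx => by
    refine Summable.of_nonneg_of_le (fun n => ?_) (fun n => ?_) (hgeom x)
    · have := ha0 n
      positivity
    · exact le_of_tendsto ((hlim n).mul_const _) (Eventually.of_forall fun m => hterm x hx _ n)
  have htend : ∀ x : ℝ, 0 < x → Tendsto (fun m => f (κ m) x) atTop (𝓝 (∑' n, a n * x ^ n)) :=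
    fun x hx => by
      have := tendsto_tsum_of_dominated_convergence (𝓕 := atTop)
        (f := fun m n => c (κ m) n * x ^ n) (g := fun n => a n * x ^ n) (hgeom x)
        (fun n => (hlim n).mul_const _) (Eventually.of_forall fun m n => by
          rw [Real.norm_of_nonneg (by have := hc (κ m) n; positivity)]
          exact hterm x hx _ n)
      refine this.congr fun m => (hsum (κ m) x hx).tsum_eq
  have hsa' : ∀ r : ℝ, 0 ≤ r → Summable fun n => |a n| * r ^ n := fun r hr => by
    simp only [abs_of_nonneg (ha0 _)]
    refine Summable.of_nonneg_of_le (fun n => ?_) (fun n => ?_) (hsa (r + 1) (by linarith))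
    · have := ha0 n
      positivity
    · have := ha0 n
      gcongr
      linarith
  have hcont : Continuous fun x : ℝ => ∑' n, a n * x ^ n := by
    have h := Complex.continuous_re.comp
      ((differentiable_tsum_of_summable hsa').continuous.comp Complex.continuous_ofReal)
    convert! h using 2 with x
    simp only [Function.comp]
    rw [← Complex.ofReal_re (∑' n, a n * x ^ n), Complex.ofReal_tsum]
    push_cast
    rfl
  refine ⟨a, ha0, fun x hx => ?_⟩
  have h1 : H x ≤ ∑' n, a n * x ^ n :=
    ge_of_tendsto (htend x hx) (Eventually.of_forall fun m => hlow _ x)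
  -- Continuity of `H` is not known, so the upper bound is proved at `y < x` and then passed to `x`
  -- by continuity of the limit series.
  have h2 : ∀ y ∈ Set.Ioo 0 x, ∑' n, a n * y ^ n ≤ H x := fun y hy => by
    refine le_of_tendsto (htend y hy.1) ?_
    filter_upwards [(hε.comp hκ.tendsto_atTop).eventually_lt_const (sub_pos.2 hy.2)] with m hm
    simp only [Function.comp] at hm
    exact (hup _ y).trans (hH (by linarith))
  have h3 : ∑' n, a n * x ^ n ≤ H x :=
    le_of_tendsto ((hcont.tendsto x).mono_left (nhdsWithin_le_nhds (s := Set.Iio x)))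
      (Filter.mem_of_superset (Ioo_mem_nhdsLT hx) h2)
  rw [le_antisymm h1 h3]
  exact (hsa x hx).hasSum

/-! ### Mollification of monotone functions -/

/-- A monotone function has smooth approximations from above, squeezed between the function and
its small translates, which inherit translation invariant linear inequalities. -/
theorem Monotone.exists_contDiff_approx {H : ℝ → ℝ} (hH : Monotone H) {ε : ℝ} (hε : 0 < ε) :
    ∃ f : ℝ → ℝ, ContDiff ℝ ∞ f ∧ (∀ x, H x ≤ f x) ∧ (∀ x, f x ≤ H (x + 2 * ε)) ∧
      ∀ (s : Finset ℕ) (w y : ℕ → ℝ), (∀ τ, 0 ≤ τ → 0 ≤ ∑ j ∈ s, w j * H (y j + τ)) →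
        0 ≤ ∑ j ∈ s, w j * f (y j) := by
  let κ : ContDiffBump (0 : ℝ) := ⟨ε / 2, ε, by linarith, by linarith⟩
  let ψ : ℝ → ℝ := κ.normed volume
  have hψ0 : ∀ t, 0 ≤ ψ t := κ.nonneg_normed
  have hψint : ∫ t, ψ t = 1 := κ.integral_normed
  have hψi : Integrable ψ := κ.integrable_normed
  have hψs : ∀ t, ψ t ≠ 0 → |t| < ε := fun t ht => by
    have : t ∈ Function.support (κ.normed volume) := ht
    rw [κ.support_normed_eq] at this
    simpa using this
  have hloc : LocallyIntegrable H := hH.locallyIntegrable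
  have hex : ∀ x, Integrable fun t => ψ t * H (x - t) := fun x =>
    (HasCompactSupport.convolutionExists_left (ContinuousLinearMap.lsmul ℝ ℝ)
      κ.hasCompactSupport_normed κ.continuous_normed hloc x)
  have hsmooth : ContDiff ℝ ∞ (ψ ⋆[ContinuousLinearMap.lsmul ℝ ℝ, volume] H) :=
    κ.hasCompactSupport_normed.contDiff_convolution_left _ κ.contDiff_normed hloc
  have hval : ∀ x, (ψ ⋆[ContinuousLinearMap.lsmul ℝ ℝ, volume] H) x = ∫ t, ψ t * H (x - t) :=
    fun x => rfl
  have hconst : ∀ v, ∫ t, ψ t * v = v := fun v => by rw [integral_mul_const, hψint, one_mul]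
  -- The kernel lives on `(-ε, ε)`; the shift by `ε` makes the average run over values of `H` on
  -- `(x, x + 2 * ε)` only. Hence the lower bound, and hence only forward translates `τ ≥ 0` enter
  -- the linear inequalities.
  refine ⟨fun x => (ψ ⋆[ContinuousLinearMap.lsmul ℝ ℝ, volume] H) (x + ε),
    hsmooth.comp (contDiff_id.add contDiff_const), fun x => ?_, fun x => ?_, fun s w y hpos => ?_⟩
  · simp only [hval]
    rw [← hconst (H x)]
    refine integral_mono (hψi.mul_const _) (hex _) fun t => ?_
    by_cases ht : ψ t = 0
    · simp [ht]
    · exact mul_le_mul_of_nonneg_left (hH (by linarith [(abs_lt.1 (hψs t ht)).2])) (hψ0 t)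
  · simp only [hval]
    rw [← hconst (H (x + 2 * ε))]
    refine integral_mono (hex _) (hψi.mul_const _) fun t => ?_
    by_cases ht : ψ t = 0
    · simp [ht]
    · exact mul_le_mul_of_nonneg_left (hH (by linarith [(abs_lt.1 (hψs t ht)).1])) (hψ0 t)
  · simp only [hval, ← integral_const_mul]
    rw [← integral_finsetSum s fun j _ => (hex _).const_mul _]
    refine integral_nonneg fun t => ?_
    by_cases ht : ψ t = 0
    · simp [ht]
    · have h := mul_nonneg (hψ0 t) (hpos (ε - t) (by linarith [(abs_lt.1 (hψs t ht)).2]))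
      rw [Finset.mul_sum] at h
      refine h.trans_eq (Finset.sum_congr rfl fun j _ => ?_)
      rw [add_sub_assoc]
      ring

/-! ### Positive definite sequences along a geometric progression -/

open Polynomial in
-- The `m`-th derivative in `b` at `0` of the tested sum is `q(u ^ m) ^ 2 * f⁽ᵐ⁾(a)`. With `q`
-- vanishing at `u ^ m` exactly for `m < n`, the first order that can survive is `n`, with a
-- positive factor.
theorem iteratedDeriv_nonneg_of_geometric {f : ℝ → ℝ} (hf : ContDiff ℝ ∞ f) {u : ℝ}
    (hu : u ∈ Set.Ioo (0 : ℝ) 1) {a : ℝ}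
    (hpos : ∀ (q : ℝ[X]) (b : ℝ), 0 ≤ b →
      0 ≤ ∑ j ∈ (q ^ 2).support, (q ^ 2).coeff j * f (a + b * u ^ j)) (n : ℕ) :
    0 ≤ iteratedDeriv n f a := by
  let q : ℝ[X] := ∏ m ∈ Finset.range n, (X - C (u ^ m))
  let g : ℝ → ℝ := fun b => ∑ j ∈ (q ^ 2).support, (q ^ 2).coeff j * f (a + b * u ^ j)
  have hsm : ∀ j, ContDiff ℝ ∞ fun b : ℝ => f (a + b * u ^ j) := fun j =>
    hf.comp (contDiff_const.add (contDiff_id.mul contDiff_const))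
  have hg : ContDiff ℝ ∞ g := ContDiff.sum fun j _ => contDiff_const.mul (hsm j)
  have hder : ∀ m, iteratedDeriv m g 0 = (q ^ 2).eval (u ^ m) * iteratedDeriv m f a := fun m => by
    have hterm : ∀ j, iteratedDeriv m (fun b : ℝ => (q ^ 2).coeff j * f (a + b * u ^ j)) 0 =
        (q ^ 2).coeff j * (u ^ m) ^ j * iteratedDeriv m f a := fun j => by
      rw [iteratedDeriv_const_mul_field]
      have hfa : ContDiff ℝ m fun z => f (a + z) :=
        (hf.comp (contDiff_const.add contDiff_id)).of_le (by exact_mod_cast le_top)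
      have h := congrFun (iteratedDeriv_comp_const_mul hfa (u ^ j)) 0
      simp only [mul_comm (u ^ j)] at h
      rw [h, iteratedDeriv_comp_const_add]
      simp only [zero_mul, add_zero]
      ring
    have hsum := iteratedDeriv_fun_sum (n := m) (x := (0 : ℝ)) (I := (q ^ 2).support)
      (f := fun j b => (q ^ 2).coeff j * f (a + b * u ^ j)) fun j _ =>
        ((contDiff_const.mul (hsm j)).of_le (by exact_mod_cast le_top)).contDiffAt
    rw [hsum, Finset.sum_congr rfl fun j _ => hterm j, ← Finset.sum_mul, eval_eq_sum,
      Polynomial.sum]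
  have hz : ∀ m < n, iteratedDeriv m g 0 = 0 := fun m hm => by
    have : q.eval (u ^ m) = 0 := by
      rw [eval_prod]
      exact Finset.prod_eq_zero (Finset.mem_range.2 hm) (by simp)
    rw [hder, eval_pow, this]
    simp
  have h := iteratedDeriv_zero_nonneg_of_vanishing hg (hpos q) hz
  rw [hder, eval_pow] at h
  have hne : q.eval (u ^ n) ≠ 0 := by
    rw [eval_prod, Finset.prod_ne_zero_iff]
    intro m hm
    have := pow_lt_pow_right_of_lt_one₀ hu.1 hu.2 (Finset.mem_range.1 hm)
    simp only [eval_sub, eval_X, eval_C]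
    linarith
  exact nonneg_of_mul_nonneg_right h (by positivity)

open Polynomial in
theorem exists_hasSum_of_monotone_of_geometric {H : ℝ → ℝ} (hH : Monotone H) {u : ℝ}
    (hu : u ∈ Set.Ioo (0 : ℝ) 1)
    (hpos : ∀ (q : ℝ[X]) (a b : ℝ), 0 ≤ a → 0 ≤ b →
      0 ≤ ∑ j ∈ (q ^ 2).support, (q ^ 2).coeff j * H (a + b * u ^ j)) :
    ∃ a : ℕ → ℝ, (∀ n, 0 ≤ a n) ∧ ∀ x : ℝ, 0 < x → HasSum (fun n => a n * x ^ n) (H x) := by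
  -- The approximation overshoots by `2 * ε`, which becomes `1 / (m + 1)`.
  choose f hf hlow hup hlin using fun m : ℕ =>
    hH.exists_contDiff_approx (ε := 1 / 2 * (1 / ((m : ℝ) + 1))) (by positivity)
  have hd : ∀ m n x, 0 ≤ x → 0 ≤ iteratedDeriv n (f m) x := fun m n x hx =>
    iteratedDeriv_nonneg_of_geometric (hf m) hu (fun q b hb =>
      hlin m _ _ (fun j => x + b * u ^ j) fun τ hτ =>
        (hpos q (x + τ) b (by linarith) hb).trans_eq
          (Finset.sum_congr rfl fun j _ => by rw [add_right_comm])) n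
  refine exists_hasSum_of_power_series_sandwich hH f
    (fun m n => iteratedDeriv n (f m) 0 / n !) (fun m n => ?_)
    (fun m x hx => hasSum_taylor_of_iteratedDeriv_nonneg (hf m) (hd m) hx)
    (fun m => 1 / ((m : ℝ) + 1)) tendsto_one_div_add_atTop_nhds_zero_nat (fun m => ?_) hlow
    fun m x => (hup m x).trans_eq (by ring_nf)
  · have := hd m n 0 le_rfl
    positivity
  · rw [div_le_one (by positivity)]
    linarith [(Nat.cast_nonneg m : (0 : ℝ) ≤ m)]

/-! ### Moments -/

open Polynomial in
theorem IsAdmissibleOn.integral_eval {K : Set ℝ} {ν : Measure ℝ} (hν : IsAdmissibleOn K ν)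
    (p : ℝ[X]) : ∫ x, p.eval x ∂ν = ∑ j ∈ p.support, p.coeff j * powerMoment ν j := by
  simp only [eval_eq_sum, Polynomial.sum, powerMoment]
  rw [integral_finsetSum _ fun j _ => (hν.integrable_pow j).const_mul _]
  simp only [integral_const_mul]

theorem IsAdmissibleOn.ae_mem {K : Set ℝ} {ν : Measure ℝ} (hν : IsAdmissibleOn K ν) :
    ∀ᵐ x ∂ν, x ∈ K := by
  rw [ae_iff]
  exact hν.compl_null

theorem IsAdmissibleOn.isFiniteMeasure {K : Set ℝ} {ν : Measure ℝ} (hν : IsAdmissibleOn K ν) :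
    IsFiniteMeasure ν := by
  have := hν.integrable_pow 0
  simpa [integrable_const_iff, isFiniteMeasure_iff] using this

theorem IsAdmissibleOn.mono {K K' : Set ℝ} {ν : Measure ℝ} (hν : IsAdmissibleOn K ν)
    (h : K ⊆ K') : IsAdmissibleOn K' ν :=
  ⟨hν.integrable_pow, measure_mono_null (Set.compl_subset_compl.2 h) hν.compl_null⟩

theorem isAdmissibleOn_dirac_add_dirac {x y a b : ℝ} :
    IsAdmissibleOn {x, y} (ENNReal.ofReal a • Measure.dirac x + ENNReal.ofReal b • Measure.dirac y)
    := by
  refine ⟨fun k => ?_, ?_⟩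
  · exact ((integrable_dirac (by simp)).smul_measure ENNReal.ofReal_ne_top).add_measure
      ((integrable_dirac (by simp)).smul_measure ENNReal.ofReal_ne_top)
  · have hm : MeasurableSet ({x, y} : Set ℝ)ᶜ := (Set.toFinite _).measurableSet.compl
    simp [Measure.dirac_apply' _ hm]

theorem powerMoment_dirac_add_dirac {x y a b : ℝ} (ha : 0 ≤ a) (hb : 0 ≤ b) (k : ℕ) :
    powerMoment (ENNReal.ofReal a • Measure.dirac x + ENNReal.ofReal b • Measure.dirac y) k =
      a * x ^ k + b * y ^ k := by
  rw [powerMoment, integral_add_measure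
    ((integrable_dirac (by simp)).smul_measure ENNReal.ofReal_ne_top)
    ((integrable_dirac (by simp)).smul_measure ENNReal.ofReal_ne_top)]
  simp [integral_smul_measure, ENNReal.toReal_ofReal ha, ENNReal.toReal_ofReal hb]

theorem two_point_mem_momentSeqs {x y a b : ℝ} (ha : 0 ≤ a) (hb : 0 ≤ b) :
    (fun k => a * x ^ k + b * y ^ k) ∈ momentSeqs {x, y} :=
  ⟨_, isAdmissibleOn_dirac_add_dirac, fun k => (powerMoment_dirac_add_dirac ha hb k).symm⟩

theorem two_point_mem_truncMomentSeqs {n : ℕ} {x y a b : ℝ} (ha : 0 ≤ a) (hb : 0 ≤ b) :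
    (fun k : Fin (n + 1) => a * x ^ (k : ℕ) + b * y ^ (k : ℕ)) ∈ truncMomentSeqs n {x, y} :=
  ⟨_, isAdmissibleOn_dirac_add_dirac, fun k => (powerMoment_dirac_add_dirac ha hb k).symm⟩

/-- Three moments of a measure on the half-line, tested against `x ^ m * (1 - x) ^ 2`. -/
theorem IsAdmissibleOn.second_difference_nonneg {ν : Measure ℝ}
    (hν : IsAdmissibleOn (Set.Ici 0) ν) (m : ℕ) :
    0 ≤ powerMoment ν m - 2 * powerMoment ν (m + 1) + powerMoment ν (m + 2) := by
  have h : 0 ≤ ∫ x, (x ^ m - 2 * x ^ (m + 1) + x ^ (m + 2)) ∂ν := by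
    refine integral_nonneg_of_ae (hν.ae_mem.mono fun x hx => ?_)
    have hx0 : 0 ≤ x := hx
    have : x ^ m - 2 * x ^ (m + 1) + x ^ (m + 2) = x ^ m * (1 - x) ^ 2 := by ring
    simp only [Pi.zero_apply]
    rw [this]
    positivity
  rwa [integral_add (f := fun x => x ^ m - 2 * x ^ (m + 1))
    ((hν.integrable_pow _).sub ((hν.integrable_pow _).const_mul _))
    (hν.integrable_pow _), integral_sub (hν.integrable_pow _) ((hν.integrable_pow _).const_mul _),
    integral_const_mul] at h

/-- The action on truncated moment sequences of `{-1, 0}` forces evenness, monotonicity and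
non-negativity. -/
theorem even_monotone_of_mapsTo_trunc {F : ℝ → ℝ}
    (h : Set.MapsTo (entrywise F) (truncMomentSeqs 4 {-1, 0}) (truncMomentSeqs 4 (Set.Ici 0))) :
    0 ≤ F 0 ∧ (∀ a, 0 ≤ a → F (-a) = F a) ∧ MonotoneOn F (Set.Ici 0) := by
  have key : ∀ a c, 0 ≤ a → a ≤ c → 0 ≤ F c ∧ F (-a) = F a ∧ F a ≤ F c := by
    intro a c ha hac
    obtain ⟨ν, hν, hs⟩ := h (two_point_mem_truncMomentSeqs (n := 4) (x := -1) (y := 0) ha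
      (sub_nonneg.2 hac))
    have h0 := hs 0
    have h1 := hs 1
    have h2 := hs 2
    have h3 := hs 3
    have h4 := hs 4
    norm_num [entrywise] at h0 h1 h2 h3 h4
    have d0 := hν.second_difference_nonneg 0
    have d1 := hν.second_difference_nonneg 1
    have d2 := hν.second_difference_nonneg 2
    -- `d1` and `d2` give the two inequalities between `F (-a)` and `F a`; `d0` then reads `F a ≤ F
    -- c`.
    norm_num [← h0, ← h1, ← h2, ← h3, ← h4] at d0 d1 d2
    have hmass : 0 ≤ F c := by
      rw [h0]
      exact integral_nonneg fun x => by simp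
    exact ⟨hmass, by linarith, by linarith⟩
  exact ⟨(key 0 0 le_rfl le_rfl).1, fun a ha => (key a a ha le_rfl).2.1,
    fun a ha c _ hac => (key a c ha hac).2.2⟩

theorem momentSeqs_mono {K K' : Set ℝ} (h : K ⊆ K') : momentSeqs K ⊆ momentSeqs K' :=
  fun _ ⟨μ, hμ, hs⟩ => ⟨μ, hμ.mono h, hs⟩

theorem truncMomentSeqs_mono {n : ℕ} {K K' : Set ℝ} (h : K ⊆ K') :
    truncMomentSeqs n K ⊆ truncMomentSeqs n K' :=
  fun _ ⟨μ, hμ, hs⟩ => ⟨μ, hμ.mono h, hs⟩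

/-- An entrywise map between moment sequences restricts to truncated moment sequences. -/
theorem mapsTo_truncMomentSeqs {F : ℝ → ℝ} {K K' : Set ℝ}
    (h : Set.MapsTo (entrywise F) (momentSeqs K) (momentSeqs K')) (n : ℕ) :
    Set.MapsTo (entrywise F) (truncMomentSeqs n K) (truncMomentSeqs n K') := by
  rintro s ⟨μ, hμ, hs⟩
  obtain ⟨ν, hν, hs'⟩ := h (show powerMoment μ ∈ momentSeqs K from ⟨μ, hμ, fun _ => rfl⟩)
  exact ⟨ν, hν, fun k => by rw [← hs' k, entrywise, entrywise, hs k]⟩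

/-! ### Multiplicative convolution of measures on the unit interval -/

/-- `[0, 1]` is closed under products, and `(x * y) ^ k` splits, so integrability passes to the
product measure. -/
theorem IsAdmissibleOn.mconv {μ ν : Measure ℝ} (hμ : IsAdmissibleOn (Set.Icc 0 1) μ)
    (hν : IsAdmissibleOn (Set.Icc 0 1) ν) : IsAdmissibleOn (Set.Icc 0 1) (μ.mconv ν) := by
  have := hμ.isFiniteMeasure
  have := hν.isFiniteMeasure
  have hm : AEMeasurable (fun p : ℝ × ℝ => p.1 * p.2) (μ.prod ν) := by fun_prop
  refine ⟨fun k => ?_, ?_⟩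
  · rw [Measure.mconv, integrable_map_measure (by fun_prop) hm]
    simpa only [Function.comp_def, mul_pow] using
      (hμ.integrable_pow k).mul_prod (hν.integrable_pow k)
  · have h1 := (Measure.quasiMeasurePreserving_fst (μ := μ) (ν := ν)).ae hμ.ae_mem
    have h2 := (Measure.quasiMeasurePreserving_snd (μ := μ) (ν := ν)).ae hν.ae_mem
    have h3 : ∀ᵐ x ∂(μ.mconv ν), x ∈ Set.Icc (0 : ℝ) 1 := by
      rw [Measure.mconv, ae_map_iff (p := (· ∈ Set.Icc (0 : ℝ) 1)) hm measurableSet_Icc]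
      filter_upwards [h1, h2] with p hp hq
      exact ⟨mul_nonneg hp.1 hq.1, mul_le_one₀ hp.2 hq.1 hq.2⟩
    exact ae_iff.1 h3

theorem powerMoment_mconv {μ ν : Measure ℝ} [SFinite μ] [SFinite ν] (k : ℕ) :
    powerMoment (μ.mconv ν) k = powerMoment μ k * powerMoment ν k := by
  rw [powerMoment, Measure.mconv, integral_map (by fun_prop) (by fun_prop)]
  simp only [mul_pow]
  exact integral_prod_mul (fun x : ℝ => x ^ k) fun x : ℝ => x ^ k

theorem IsAdmissibleOn.exists_powerMoment_pow {μ : Measure ℝ}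
    (hμ : IsAdmissibleOn (Set.Icc 0 1) μ) (n : ℕ) :
    ∃ ν, IsAdmissibleOn (Set.Icc 0 1) ν ∧ ∀ k, powerMoment ν k = powerMoment μ k ^ n := by
  induction n with
  | zero =>
    -- The zeroth power is the constant sequence `1`, the moments of a unit mass at `1`.
    refine ⟨Measure.dirac 1, ⟨fun k => integrable_dirac (by simp), ?_⟩, fun k => ?_⟩
    · simp [Measure.dirac_apply' _ (measurableSet_Icc (a := (0 : ℝ)) (b := 1)).compl]
    · simp [powerMoment]
  | succ n ih =>
    obtain ⟨ν, hν, h⟩ := ih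
    have := hμ.isFiniteMeasure
    have := hν.isFiniteMeasure
    exact ⟨ν.mconv μ, hν.mconv hμ, fun k => by rw [powerMoment_mconv, h, pow_succ]⟩

/-- A power series with non-negative coefficients maps moment sequences of measures on the unit
interval to such sequences. -/
theorem IsAdmissibleOn.power_series_mem_momentSeqs {μ : Measure ℝ}
    (hμ : IsAdmissibleOn (Set.Icc 0 1) μ) {a : ℕ → ℝ} (ha : ∀ n, 0 ≤ a n) {s : ℕ → ℝ}
    (hs : ∀ k, HasSum (fun n => a n * powerMoment μ k ^ n) (s k)) :
    s ∈ momentSeqs (Set.Icc 0 1) := by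
  choose ν hν hmom using hμ.exists_powerMoment_pow
  have hint : ∀ n k, Integrable (fun x : ℝ => x ^ k) (ENNReal.ofReal (a n) • ν n) := fun n k =>
    ((hν n).integrable_pow k).smul_measure ENNReal.ofReal_ne_top
  have hval : ∀ n k, ∫ x, x ^ k ∂(ENNReal.ofReal (a n) • ν n) = a n * powerMoment μ k ^ n :=
    fun n k => by
      rw [integral_smul_measure, ENNReal.toReal_ofReal (ha n), smul_eq_mul, ← hmom]
      rfl
  have hae : ∀ n, ∀ᵐ x ∂(ENNReal.ofReal (a n) • ν n), x ∈ Set.Icc (0 : ℝ) 1 := fun n =>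
    Measure.ae_smul_measure (hν n).ae_mem _
  have hsumint : ∀ k, Integrable (fun x : ℝ => x ^ k)
      (Measure.sum fun n => ENNReal.ofReal (a n) • ν n) := fun k => by
    -- On `[0, 1]` the norm of `x ^ k` is `x ^ k`, so the required summability is that of the given
    -- series.
    refine integrable_sum_measure (fun n => hint n k) ((hs k).summable.congr fun n => ?_)
    rw [← hval]
    refine integral_congr_ae ((hae n).mono fun x hx => ?_)
    simp only
    rw [Real.norm_of_nonneg (pow_nonneg hx.1 k)]
  refine ⟨Measure.sum fun n => ENNReal.ofReal (a n) • ν n, ⟨hsumint, ?_⟩, fun k => ?_⟩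
  · rw [Measure.sum_apply _ measurableSet_Icc.compl]
    simp [(hν _).compl_null]
  · have h := hasSum_integral_measure (hsumint k)
    simp only [hval] at h
    exact (hs k).unique h

/-! ### Reflection to the unit interval and sufficiency of the power series form -/

theorem IsAdmissibleOn.map_neg {μ : Measure ℝ} (hμ : IsAdmissibleOn (Set.Icc (-1) 0) μ) :
    IsAdmissibleOn (Set.Icc 0 1) (μ.map fun x => -x) := by
  refine ⟨fun k => ?_, ?_⟩
  · rw [integrable_map_measure (by fun_prop) (by fun_prop)]
    simp only [Function.comp_def]
    exact ((hμ.integrable_pow k).const_mul ((-1) ^ k)).congr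
      (Eventually.of_forall fun x => (neg_pow x k).symm)
  · rw [Measure.map_apply measurable_neg measurableSet_Icc.compl]
    convert! hμ.compl_null using 2
    ext x
    simp only [Set.mem_preimage, Set.mem_compl_iff, Set.mem_Icc]
    constructor <;> intro h h' <;> exact h ⟨by linarith [h'.1, h'.2], by linarith [h'.1, h'.2]⟩

theorem powerMoment_map_neg (μ : Measure ℝ) (k : ℕ) :
    powerMoment (μ.map fun x => -x) k = (-1) ^ k * powerMoment μ k := by
  rw [powerMoment, integral_map (by fun_prop) (by fun_prop), powerMoment, ← integral_const_mul]
  exact integral_congr_ae (Eventually.of_forall fun x => neg_pow x k)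

theorem IsAdmissibleOn.powerMoment_nonneg {μ : Measure ℝ} {K : Set ℝ} (hμ : IsAdmissibleOn K μ)
    (hK : K ⊆ Set.Ici 0) (k : ℕ) : 0 ≤ powerMoment μ k :=
  integral_nonneg_of_ae (hμ.ae_mem.mono fun _ hx => pow_nonneg (hK hx) k)

/-- If some moment vanishes, then so do all moments of positive order. -/
theorem IsAdmissibleOn.powerMoment_eq_zero {μ : Measure ℝ} {K : Set ℝ} (hμ : IsAdmissibleOn K μ)
    (hK : K ⊆ Set.Ici 0) {k : ℕ} (hk : powerMoment μ k = 0) {j : ℕ} (hj : j ≠ 0) :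
    powerMoment μ j = 0 := by
  have h0 : (fun x : ℝ => x ^ k) =ᵐ[μ] 0 :=
    (integral_eq_zero_iff_of_nonneg_ae (hμ.ae_mem.mono fun _ hx => pow_nonneg (hK hx) k)
      (hμ.integrable_pow k)).1 hk
  refine integral_eq_zero_of_ae (h0.mono fun x hx => ?_)
  have : x = 0 := eq_zero_of_pow_eq_zero hx
  simp [this, hj]

theorem mapsTo_momentSeqs_of_power_series {F : ℝ → ℝ} {a : ℕ → ℝ} (ha : ∀ n, 0 ≤ a n)
    (hF : ∀ x : ℝ, 0 < x → HasSum (fun n => a n * x ^ n) (F x))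
    (heven : ∀ x : ℝ, 0 < x → F (-x) = F x) (h0 : 0 ≤ F 0) (h0a : F 0 ≤ a 0) :
    Set.MapsTo (entrywise F) (momentSeqs (Set.Icc (-1) 0)) (momentSeqs (Set.Icc 0 1)) := by
  rintro s ⟨μ, hμ, hs⟩
  have hν := hμ.map_neg
  set ν := μ.map fun x : ℝ => -x
  have hK : Set.Icc (0 : ℝ) 1 ⊆ Set.Ici 0 := fun x hx => hx.1
  have hst : ∀ k, s k = (-1) ^ k * powerMoment ν k := fun k => by
    rw [powerMoment_map_neg, ← mul_assoc, ← mul_pow, hs]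
    norm_num
  by_cases hz : ∃ k, powerMoment ν k = 0
  -- Degenerate case: all moments of positive order vanish, so the image is `(F s₀, F 0, F 0, …)`,
  -- realised by `(F s₀ - F 0) δ_0 + F 0 δ_1`. The bounds `0 ≤ F 0 ≤ a 0` make both weights
  -- non-negative.
  · obtain ⟨k, hk⟩ := hz
    have hj : ∀ j, j ≠ 0 → powerMoment ν j = 0 := fun j hj => hν.powerMoment_eq_zero hK hk hj
    have hle : F 0 ≤ F (powerMoment ν 0) := by
      rcases (hν.powerMoment_nonneg hK 0).eq_or_lt with h | h
      · rw [← h]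
      · refine h0a.trans ?_
        simpa using le_hasSum (hF _ h) 0 fun n _ => mul_nonneg (ha n) (pow_nonneg h.le n)
    refine momentSeqs_mono (K := {0, 1}) (by rintro x (rfl | rfl) <;> simp) ?_
    convert! two_point_mem_momentSeqs (x := 0) (y := 1) (sub_nonneg.2 hle) h0 using 2 with j
    rcases eq_or_ne j 0 with rfl | hj0
    · simp [entrywise, hst]
    · simp [entrywise, hst, hj j hj0, hj0]
  · push Not at hz
    have hpos : ∀ k, 0 < powerMoment ν k := fun k =>
      (hν.powerMoment_nonneg hK k).lt_of_ne' (hz k)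
    refine hν.power_series_mem_momentSeqs ha fun k => ?_
    have : entrywise F s k = F (powerMoment ν k) := by
      rw [entrywise, hst]
      rcases neg_one_pow_eq_or ℝ k with h | h
      · rw [h, one_mul]
      · rw [h, neg_one_mul, heven _ (hpos k)]
    rw [this]
    exact hF _ (hpos k)

/-! ### Necessity of the power series form, and the equivalence -/

/-- The action on moment sequences of `{-1, -u}` yields positive semidefiniteness along geometric
progressions. -/
theorem geometric_nonneg_of_mapsTo {F : ℝ → ℝ} {u : ℝ} (hu : 0 ≤ u)
    (h : Set.MapsTo (entrywise F) (momentSeqs {-1, -u}) (momentSeqs (Set.Ici 0)))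
    (heven : ∀ a, 0 ≤ a → F (-a) = F a) (q : Polynomial ℝ) {a b : ℝ} (ha : 0 ≤ a) (hb : 0 ≤ b) :
    0 ≤ ∑ j ∈ (q ^ 2).support, (q ^ 2).coeff j * F (a + b * u ^ j) := by
  obtain ⟨ν, hν, hs⟩ := h (two_point_mem_momentSeqs (x := -1) (y := -u) ha hb)
  have hF : ∀ j, F (a + b * u ^ j) = powerMoment ν j := fun j => by
    rw [← hs j, entrywise]
    have : a * (-1) ^ j + b * (-u) ^ j = (-1) ^ j * (a + b * u ^ j) := by
      rw [neg_pow u]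
      ring
    rw [this]
    rcases neg_one_pow_eq_or ℝ j with h | h
    · rw [h, one_mul]
    · rw [h, neg_one_mul, heven _ (by positivity)]
  simp only [hF]
  rw [← hν.integral_eval]
  exact integral_nonneg fun x => by simp only [Polynomial.eval_pow]; positivity

theorem exists_absMonotonicEntire_of_mapsTo {F : ℝ → ℝ} {u : ℝ} (hu : u ∈ Set.Ioo (0 : ℝ) 1)
    (h : Set.MapsTo (entrywise F) (momentSeqs {-1, -u}) (momentSeqs (Set.Ici 0)))
    (htr : Set.MapsTo (entrywise F) (truncMomentSeqs 4 {-1, 0}) (truncMomentSeqs 4 (Set.Ici 0))) :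
    (∃ G : ℂ → ℂ, IsAbsMonotonicEntire G ∧
        (∀ x : ℝ, 0 < x → (F x : ℂ) = G (x : ℂ)) ∧
        (∀ x : ℝ, x < 0 → (F x : ℂ) = G ((-x : ℝ) : ℂ))) ∧
      0 ≤ F 0 ∧ ∃ L : ℝ, Tendsto F (𝓝[≠] 0) (𝓝 L) ∧ F 0 ≤ L := by
  obtain ⟨h0, heven, hmono⟩ := even_monotone_of_mapsTo_trunc htr
  -- Extending `F` by the constant `F 0` to the left of `0` gives a function monotone on the whole
  -- line, as mollification requires.
  have hH : Monotone fun x => F (max x 0) := fun x y hxy =>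
    hmono (Set.mem_Ici.2 (le_max_right _ _)) (Set.mem_Ici.2 (le_max_right _ _)) (max_le_max hxy le_rfl)
  obtain ⟨a, ha, hsum⟩ := exists_hasSum_of_monotone_of_geometric hH hu fun q c b hc hb => by
    have hmax : ∀ j : ℕ, max (c + b * u ^ j) 0 = c + b * u ^ j := fun j => by
      have := hu.1
      exact max_eq_left (by positivity)
    simp only [hmax]
    exact geometric_nonneg_of_mapsTo hu.1.le h heven q hc hb
  have hsumF : ∀ x : ℝ, 0 < x → HasSum (fun n => a n * x ^ n) (F x) := fun x hx => by
    simpa [max_eq_left hx.le] using hsum x hx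
  have hG : IsAbsMonotonicEntire fun z : ℂ => ∑' n, (a n : ℂ) * z ^ n :=
    .of_hasSum ha fun r hr => by
      rcases hr.eq_or_lt with rfl | hr
      · exact summable_of_ne_finset_zero (s := {0}) fun n hn => by
          simp [Finset.mem_singleton.not.1 hn]
      · exact (hsumF r hr).summable
  have hpos : ∀ x : ℝ, 0 < x → (F x : ℂ) = ∑' n, (a n : ℂ) * (x : ℂ) ^ n := fun x hx => by
    rw [← (hsumF x hx).tsum_eq, Complex.ofReal_tsum]
    push_cast
    rfl
  have hneg : ∀ x : ℝ, x < 0 → F x = F (-x) := fun x hx => by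
    rw [← heven (-x) (by linarith), neg_neg]
  have habs : ∀ x : ℝ, x ≠ 0 → F x = F |x| := fun x hx => by
    rcases lt_or_gt_of_ne hx with hx | hx
    · rw [abs_of_neg hx, hneg x hx]
    · rw [abs_of_pos hx]
  have hlim : Tendsto F (𝓝[≠] 0) (𝓝 (∑' n, (a n : ℂ) * (0 : ℂ) ^ n).re) := by
    have hc : Continuous fun x : ℝ => (∑' n, (a n : ℂ) * ((|x| : ℝ) : ℂ) ^ n).re :=
      Complex.continuous_re.comp (hG.entire.continuous.comp
        (Complex.continuous_ofReal.comp continuous_abs))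
    have ht := (hc.tendsto 0).mono_left (nhdsWithin_le_nhds (s := {0}ᶜ))
    simp only [abs_zero, Complex.ofReal_zero] at ht
    refine ht.congr' (eventually_mem_nhdsWithin.mono fun x hx => ?_)
    rw [habs x hx, ← hpos _ (abs_pos.2 hx), Complex.ofReal_re]
  refine ⟨⟨_, hG, hpos, fun x hx => ?_⟩, h0, _, hlim, ?_⟩
  · rw [hneg x hx]
    exact hpos _ (by linarith)
  · refine ge_of_tendsto hlim (eventually_mem_nhdsWithin.mono fun x hx => ?_)
    rw [habs x hx]
    exact hmono Set.self_mem_Ici (abs_nonneg x) (abs_nonneg x)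

theorem mapsTo_momentSeqs_of_absMonotonicEntire {F : ℝ → ℝ} {G : ℂ → ℂ}
    (hG : IsAbsMonotonicEntire G) (hpos : ∀ x : ℝ, 0 < x → (F x : ℂ) = G (x : ℂ))
    (hneg : ∀ x : ℝ, x < 0 → (F x : ℂ) = G ((-x : ℝ) : ℂ)) (h0 : 0 ≤ F 0) {L : ℝ}
    (hL : Tendsto F (𝓝[≠] 0) (𝓝 L)) (h0L : F 0 ≤ L) :
    Set.MapsTo (entrywise F) (momentSeqs (Set.Icc (-1) 0)) (momentSeqs (Set.Icc 0 1)) := by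
  obtain ⟨a, ha, hsum⟩ := hG.exists_hasSum
  have hG0 : G 0 = a 0 := by
    have h := hsum 0
    simp only [Complex.ofReal_zero] at h
    refine h.unique ?_
    convert! hasSum_single (f := fun n => ((a n * 0 ^ n : ℝ) : ℂ)) 0 fun n hn => ?_ using 1
    · simp
    · simp [hn]
  -- The punctured limit is computed from the right, where `F` agrees with the continuous `G`; so
  -- the bound on `F 0` becomes a bound by the constant coefficient.
  have hLa : L = a 0 := by
    have hc : Tendsto (fun x : ℝ => (G x).re) (𝓝[>] 0) (𝓝 (G 0).re) := by
      have hc : Continuous fun x : ℝ => (G x).re :=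
        Complex.continuous_re.comp (hG.entire.continuous.comp Complex.continuous_ofReal)
      simpa using (hc.tendsto 0).mono_left nhdsWithin_le_nhds
    rw [hG0, Complex.ofReal_re] at hc
    refine tendsto_nhds_unique (hL.mono_left (nhdsGT_le_nhdsNE 0))
      (hc.congr' (eventually_mem_nhdsWithin.mono fun x hx => ?_))
    rw [← hpos x hx, Complex.ofReal_re]
  refine mapsTo_momentSeqs_of_power_series ha (fun x hx => ?_) (fun x hx => ?_) h0 (hLa ▸ h0L)
  · have h := hsum x
    rw [← hpos x hx] at h
    exact Complex.hasSum_ofReal.1 h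
  · have h := hneg (-x) (by linarith)
    rw [neg_neg, ← hpos x hx] at h
    exact_mod_cast h

theorem theorem6p3 (F : ℝ → ℝ) (u₀ : ℝ) (hu₀ : u₀ ∈ Set.Ioo (0 : ℝ) 1) :
    List.TFAE
      [ Set.MapsTo (entrywise F) (momentSeqs {-1, -u₀}) (momentSeqs (Set.Ici 0)) ∧
          Set.MapsTo (entrywise F)
            (truncMomentSeqs 4 {-1, 0} ∪ ⋃ u ∈ Set.Ioo (0 : ℝ) 1, truncMomentSeqs 4 {-u})
            (truncMomentSeqs 4 (Set.Ici 0)),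
        Set.MapsTo (entrywise F) (momentSeqs (Set.Icc (-1) 0)) (momentSeqs (Set.Icc 0 1)),
        (∃ G : ℂ → ℂ, IsAbsMonotonicEntire G ∧
            (∀ x : ℝ, 0 < x → (F x : ℂ) = G (x : ℂ)) ∧
            (∀ x : ℝ, x < 0 → (F x : ℂ) = G ((-x : ℝ) : ℂ))) ∧
          0 ≤ F 0 ∧ ∃ L : ℝ, Tendsto F (𝓝[≠] 0) (𝓝 L) ∧ F 0 ≤ L ] := by
  tfae_have 1 → 3 := fun h =>
    exists_absMonotonicEntire_of_mapsTo hu₀ h.1 (h.2.mono_left Set.subset_union_left)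
  tfae_have 3 → 2 := by
    rintro ⟨⟨G, hG, hpos, hneg⟩, h0, L, hL, h0L⟩
    exact mapsTo_momentSeqs_of_absMonotonicEntire hG hpos hneg h0 hL h0L
  tfae_have 2 → 1 := by
    intro h
    have hK : Set.Icc (0 : ℝ) 1 ⊆ Set.Ici 0 := fun x hx => hx.1
    refine ⟨(h.mono_left (momentSeqs_mono ?_)).mono_right (momentSeqs_mono hK),
      ((mapsTo_truncMomentSeqs h 4).mono_left ?_).mono_right (truncMomentSeqs_mono hK)⟩
    · rintro x (rfl | rfl)
      · simp
      · exact ⟨by linarith [hu₀.2], by linarith [hu₀.1]⟩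
    · refine Set.union_subset (truncMomentSeqs_mono ?_)
        (Set.iUnion₂_subset fun u hu => truncMomentSeqs_mono ?_)
      · rintro x (rfl | rfl) <;> simp
      · rintro x rfl
        exact ⟨by linarith [hu.2], by linarith [hu.1]⟩
  tfae_finish
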